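/- Let $\mathbb{F}_q$ be a finite field with $q$ odd, and let $\widehat{\mathbb{F}_q^\times}$ be the group of characters $\chi:\mathbb{F}_q^\times\to\mathbb{C}^\times$, each extended to $\mathbb{F}_q$ by $\chi(0)=0$ (including the trivial character). Write $\overline{\chi}=\chi^{-1}$, let $\phi$ be the quadratic character, and let $\delta(0)=1$ and $\delta(x)=0$ for $x\in\mathbb{F}_q^\times$. For characters $A,B,A_1,A_2,B_1$ and $\lambda\in\mathbb{F}_q$ put $$J(A,B)=\sum_{y\in\mathbb{F}_q}A(y)B(1-y),$$ $${}_2\mathbb{F}_1\left[\begin{matrix}A_1&A_2\\&B_1\end{matrix};\lambda\right]=\frac{1}{J(A_2,B_1\overline{A_2})}\sum_{y\in\mathbb{F}_q}A_2(y)\,\overline{A_2}B_1(1-y)\,\overline{A_1}(1-\lambda y).$$ Let $B,D\in\widehat{\mathbb{F}_q^\times}$ and set $C=D^2$. If $D\neq\phi$ and $B\neq D$, then for all $x\in\mathbb{F}_q$ $$\overline{C}(1-x)\;{}_2\mathbb{F}_1\left[\begin{matrix}D\phi\overline{B}&D\\&C\overline{B}\end{matrix};\frac{-4x}{(1-x)^2}\right]={}_2\mathbb{F}_1\left[\begin{matrix}B&C\\&C\overline{B}\end{matrix};x\right]-\delta(1-x)\frac{J(C,\overline{B}^2)}{J(C,\overline{B})}-\delta(1+x)\frac{J(\overline{B},D\phi)}{J(C,\overline{B})},$$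 where for $x=1$ the left-hand side is understood to be $0$, because of the factor $\overline{C}(0)=0$. -/

import Mathlib

noncomputable section

namespace FFHyp

variable {F : Type*} [Field F] [Fintype F]

/-- The quadratic character of a finite field, with complex values. -/
def phi (F : Type*) [Field F] [Fintype F] [DecidableEq F] : MulChar F ℂ :=
  (quadraticChar F).ringHomComp (Int.castRingHom ℂ)

/-- The indicator function of `0` on the field, with complex values. -/
def delta [DecidableEq F] (x : F) : ℂ := if x = 0 then 1 else 0

/-- The period function `₁ℙ₀[A; x] = A⁻¹(1 - x)`. -/
def P10 (A : MulChar F ℂ) (x : F) : ℂ := A⁻¹ (1 - x)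

/-- The period function `₂ℙ₁[A₁, A₂; B₁; lam]`. -/
def P21 (A₁ A₂ B₁ : MulChar F ℂ) (lam : F) : ℂ :=
  ∑ y : F, A₂ y * (A₂⁻¹ * B₁) (1 - y) * P10 A₁ (lam * y)

/-- The normalized hypergeometric function `₂𝔽₁[A₁, A₂; B₁; lam]`. The Jacobi sum in the
denominator never vanishes when the field has more than two elements. -/
def F21 (A₁ A₂ B₁ : MulChar F ℂ) (lam : F) : ℂ :=
  1 / jacobiSum A₂ (B₁ * A₂⁻¹) * P21 A₁ A₂ B₁ lam

end FFHyp

end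

/-!
Pfaff's transformation turns the argument `-4x / (1 - x)²` on the left into `4x / (1 + x)²`, and
both sides are then compared through their Mellin transforms in `x` at a character `η`. On the
right this is a product of two Jacobi sums. On the left it is a sum of products of Jacobi sums over
all characters `χ`; the duplication formula for Gauss sums turns it into the sum of Barnes' first
lemma, which evaluates to the same product. Jacobi sums are quotients of Gauss sums only up to
degenerate cases: here the exceptional characters are those with `(Dχ)² = 1`, and together they
contribute a constant times `η(-1)`, the Mellin transform of a function supported at `x = -1`.
This proves the identity away from `0` and `±1`; the three remaining points are evaluated directly,
`-1` by Kummer's theorem.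
-/

noncomputable section

namespace FFHyp

/-! ### Orthogonality and the Mellin transform -/

section Mellin

variable {F R : Type*} [Field F] [CommRing R]

theorem inv_apply_neg_one (χ : MulChar F R) : χ⁻¹ (-1) = χ (-1) := by
  rw [MulChar.inv_apply', inv_neg_one]

theorem apply_neg_one_mul_self (χ : MulChar F R) : χ (-1) * χ (-1) = 1 := by
  rw [← map_mul, neg_mul_neg, one_mul, MulChar.map_one]

theorem inv_apply_mul_apply (χ : MulChar F R) {a : F} (ha : a ≠ 0) : χ⁻¹ a * χ a = 1 := by
  rw [← MulChar.mul_apply, inv_mul_cancel, MulChar.one_apply ha.isUnit]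

variable [Fintype F]

/-- The Mellin transform of a function on a finite field: its Fourier transform along the
multiplicative group. The value at `0` plays no role, since `χ⁻¹ 0 = 0`. -/
def mellinTransform (f : F → R) (χ : MulChar F R) : R :=
  ∑ x, χ⁻¹ x * f x

theorem mellinTransform_mul_sub_mul (a b : R) (f g : F → R) (χ : MulChar F R) :
    mellinTransform (fun x ↦ a * f x - b * g x) χ =
      a * mellinTransform f χ - b * mellinTransform g χ := by
  simp_rw [mellinTransform, Finset.mul_sum, ← Finset.sum_sub_distrib]
  exact Finset.sum_congr rfl fun x _ ↦ by ring

theorem cast_card_units [DecidableEq F] : (Fintype.card Fˣ : R) = Fintype.card F - 1 := by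
  rw [Fintype.card_eq_card_units_add_one (α := F), Nat.cast_add_one, add_sub_cancel_right]

theorem cast_card_ne_zero [CharZero R] : (Fintype.card F : R) ≠ 0 :=
  Nat.cast_ne_zero.mpr Fintype.card_ne_zero

theorem cast_card_sub_one_ne_zero [CharZero R] : (Fintype.card F : R) - 1 ≠ 0 :=
  sub_ne_zero.mpr (Nat.cast_ne_one.mpr Fintype.one_lt_card.ne')

theorem sum_mul_apply_one_add (A B : MulChar F R) :
    ∑ x, A x * B (1 + x) = A (-1) * jacobiSum A B := by
  rw [jacobiSum, Finset.mul_sum]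
  refine Fintype.sum_equiv (Equiv.neg F) _ _ fun x ↦ ?_
  rw [Equiv.neg_apply, ← mul_assoc, ← map_mul, neg_mul_neg, one_mul, sub_neg_eq_add]

variable [IsDomain R]

theorem sum_apply_eq_ite [DecidableEq (MulChar F R)] (χ : MulChar F R) :
    ∑ x, χ x = if χ = 1 then (Fintype.card F : R) - 1 else 0 := by
  classical
  split_ifs with h
  · rw [h, MulChar.sum_one_eq_card_units, cast_card_units]
  · exact MulChar.sum_eq_zero_of_ne_one h

variable [HasEnoughRootsOfUnity R (Monoid.exponent Fˣ)]

theorem sum_mulChar_apply_eq_ite [Fintype (MulChar F R)] [DecidableEq F] (a : F) :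
    ∑ χ : MulChar F R, χ a = if a = 1 then (Fintype.card F : R) - 1 else 0 := by
  split_ifs with h
  · simp only [h, MulChar.map_one, Finset.sum_const, Finset.card_univ, nsmul_eq_mul, mul_one]
    rw [← Nat.card_eq_fintype_card, MulChar.card_eq_card_units_of_hasEnoughRootsOfUnity,
      Nat.card_eq_fintype_card, cast_card_units]
  · obtain ⟨χ, hχ⟩ := MulChar.exists_apply_ne_one_of_hasEnoughRootsOfUnity F R h
    refine eq_zero_of_mul_eq_self_left hχ ?_
    simp only [Finset.mul_sum, ← MulChar.mul_apply]
    exact Equiv.sum_comp (Equiv.mulLeft χ) fun χ' ↦ χ' a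

theorem sum_apply_mul_inv_apply [Fintype (MulChar F R)] [DecidableEq F] {x : F} (hx : x ≠ 0)
    (y : F) :
    ∑ χ : MulChar F R, χ x * χ⁻¹ y = if y = x then (Fintype.card F : R) - 1 else 0 := by
  have h_iff : x * y⁻¹ = 1 ↔ y = x := by
    rw [← div_eq_mul_inv]
    rcases eq_or_ne y 0 with rfl | hy
    · simp [hx.symm]
    · rw [div_eq_one_iff_eq hy, eq_comm]
  simp_rw [MulChar.inv_apply', ← map_mul, sum_mulChar_apply_eq_ite, h_iff]

theorem sum_apply_mul_mellinTransform [Fintype (MulChar F R)] (f : F → R) {x : F} (hx : x ≠ 0) :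
    ∑ χ : MulChar F R, χ x * mellinTransform f χ = (Fintype.card F - 1) * f x := by
  classical
  simp_rw [mellinTransform, Finset.mul_sum, ← mul_assoc]
  rw [Finset.sum_comm]
  simp_rw [← Finset.sum_mul, sum_apply_mul_inv_apply hx, ite_mul, zero_mul,
    Finset.sum_ite_eq', Finset.mem_univ, if_true]

theorem sum_mellinTransform_mul [Fintype (MulChar F R)] (f g : F → R) (hg : g 0 = 0) :
    ∑ χ : MulChar F R, mellinTransform f χ * ∑ x, χ x * g x =
      (Fintype.card F - 1) * ∑ x, f x * g x := by
  simp_rw [Finset.mul_sum]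
  rw [Finset.sum_comm]
  refine Finset.sum_congr rfl fun x _ ↦ ?_
  rcases eq_or_ne x 0 with rfl | hx
  · simp only [hg, mul_zero, Finset.sum_const_zero]
  · rw [← mul_assoc, ← sum_apply_mul_mellinTransform f hx, Finset.sum_mul]
    exact Finset.sum_congr rfl fun χ _ ↦ by ring

/-- The right-hand side of `hf` is the Mellin transform of `c` times the indicator of `a`. -/
theorem eq_zero_of_mellinTransform_eq [CharZero R] {f : F → R} {a : F} {c : R}
    (hf : ∀ χ : MulChar F R, mellinTransform f χ = c * χ⁻¹ a) {x : F} (hx : x ≠ 0) (hxa : x ≠ a) :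
    f x = 0 := by
  classical
  cases nonempty_fintype (MulChar F R)
  have h := sum_apply_mul_mellinTransform f hx
  simp_rw [hf, mul_left_comm _ c, ← Finset.mul_sum, sum_apply_mul_inv_apply hx,
    if_neg hxa.symm, mul_zero] at h
  exact (mul_eq_zero.mp h.symm).resolve_left cast_card_sub_one_ne_zero

end Mellin

/-! ### Gauss and Jacobi sums -/

section GaussSum

variable {F R : Type*} [Field F] [Fintype F] [CommRing R] [IsDomain R] {ψ : AddChar F R}

theorem gaussSum_one_of_isPrimitive (hψ : ψ.IsPrimitive) : gaussSum (1 : MulChar F R) ψ = -1 :=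
  gaussSum_one_left fun h ↦ hψ one_ne_zero (by rw [h, AddChar.mulShift_one])

theorem gaussSum_mul_gaussSum_inv (hψ : ψ.IsPrimitive) {χ : MulChar F R} (hχ : χ ≠ 1) :
    gaussSum χ ψ * gaussSum χ⁻¹ ψ = Fintype.card F * χ (-1) := by
  rw [← gaussSum_mul_gaussSum_eq_card hχ hψ, ← mul_gaussSum_inv_eq_gaussSum χ⁻¹ ψ,
    inv_apply_neg_one]
  ring

theorem card_mul_jacobiSum (hψ : ψ.IsPrimitive) {a b : MulChar F R} (hab : ¬(a = 1 ∧ b = 1)) :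
    Fintype.card F * jacobiSum a b =
      (a * b) (-1) * gaussSum a ψ * gaussSum b ψ * gaussSum (a * b)⁻¹ ψ := by
  by_cases h : a * b = 1
  · obtain rfl : b = a⁻¹ := eq_inv_of_mul_eq_one_right h
    have ha : a ≠ 1 := fun ha ↦ hab ⟨ha, by rw [ha, inv_one]⟩
    rw [h, inv_one, jacobiSum_nontrivial_inv ha, gaussSum_one_of_isPrimitive hψ,
      MulChar.one_apply isUnit_one.neg]
    linear_combination gaussSum_mul_gaussSum_inv hψ ha
  · linear_combination (a * b) (-1) * gaussSum (a * b)⁻¹ ψ * jacobiSum_mul_nontrivial h ψ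
      - (a * b) (-1) * jacobiSum a b * gaussSum_mul_gaussSum_inv hψ h
      - Fintype.card F * jacobiSum a b * apply_neg_one_mul_self (a * b)

variable [CharZero R]

theorem gaussSum_ne_zero (hψ : ψ.IsPrimitive) (χ : MulChar F R) : gaussSum χ ψ ≠ 0 := by
  rcases eq_or_ne χ 1 with rfl | hχ
  · rw [gaussSum_one_of_isPrimitive hψ]
    exact neg_ne_zero.mpr one_ne_zero
  · exact gaussSum_ne_zero_of_nontrivial cast_card_ne_zero hχ hψ

theorem jacobiSum_ne_zero (hψ : ψ.IsPrimitive) (hF : ringChar F ≠ 2) (a b : MulChar F R) :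
    jacobiSum a b ≠ 0 := by
  by_cases hab : a = 1 ∧ b = 1
  · rw [hab.1, hab.2, jacobiSum_one_one, sub_ne_zero]
    have h_odd := FiniteField.odd_card_of_char_ne_two hF
    exact_mod_cast (by omega : Fintype.card F ≠ 2)
  · refine right_ne_zero_of_mul (a := (Fintype.card F : R)) ?_
    rw [card_mul_jacobiSum hψ hab]
    exact mul_ne_zero (mul_ne_zero (mul_ne_zero (left_ne_zero_of_mul_eq_one
      (apply_neg_one_mul_self _)) (gaussSum_ne_zero hψ _)) (gaussSum_ne_zero hψ _))
      (gaussSum_ne_zero hψ _)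

theorem jacobiSum_mul_gaussSum_inv [DecidableEq (MulChar F R)] (hψ : ψ.IsPrimitive)
    (a b : MulChar F R) :
    jacobiSum a b * gaussSum b⁻¹ ψ =
      a (-1) * gaussSum a ψ * gaussSum (a * b)⁻¹ ψ
        - if b = 1 then (Fintype.card F : R) - 1 else 0 := by
  split_ifs with hb
  · subst hb
    rw [inv_one, mul_one, gaussSum_one_of_isPrimitive hψ]
    rcases eq_or_ne a 1 with rfl | ha
    · rw [jacobiSum_one_one, inv_one, gaussSum_one_of_isPrimitive hψ,
        MulChar.one_apply isUnit_one.neg]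
      ring
    · rw [jacobiSum_comm, jacobiSum_one_nontrivial ha]
      linear_combination -a (-1) * gaussSum_mul_gaussSum_inv hψ ha
        - Fintype.card F * apply_neg_one_mul_self a
  · refine mul_left_cancel₀ (cast_card_ne_zero (F := F)) ?_
    have h_card := card_mul_jacobiSum hψ fun h : a = 1 ∧ b = 1 ↦ hb h.2
    rw [MulChar.mul_apply] at h_card
    linear_combination gaussSum b⁻¹ ψ * h_card
      + a (-1) * b (-1) * gaussSum a ψ * gaussSum (a * b)⁻¹ ψ * gaussSum_mul_gaussSum_inv hψ hb
      + Fintype.card F * a (-1) * gaussSum a ψ * gaussSum (a * b)⁻¹ ψ * apply_neg_one_mul_self b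

theorem jacobiSum_mul_gaussSum_mul_gaussSum (hψ : ψ.IsPrimitive) {a b a' b' : MulChar F R}
    (h : a * b = a' * b') (hab : ¬(a = 1 ∧ b = 1)) (hab' : ¬(a' = 1 ∧ b' = 1)) :
    jacobiSum a b * (gaussSum a' ψ * gaussSum b' ψ) =
      jacobiSum a' b' * (gaussSum a ψ * gaussSum b ψ) := by
  refine mul_left_cancel₀ (cast_card_ne_zero (F := F)) ?_
  rw [← mul_assoc, ← mul_assoc (Fintype.card F : R), card_mul_jacobiSum hψ hab,
    card_mul_jacobiSum hψ hab', h]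
  ring

end GaussSum

/-! ### Barnes' first lemma -/

section Barnes

variable {F R : Type*} [Field F] [Fintype F] [CommRing R] (ψ : AddChar F R)

theorem gaussSum_mulShift_eq_add_ite [IsDomain R] [DecidableEq F] [DecidableEq (MulChar F R)]
    (χ : MulChar F R) (r : F) :
    gaussSum χ (ψ.mulShift r) =
      χ⁻¹ r * gaussSum χ ψ + if r = 0 ∧ χ = 1 then (Fintype.card F : R) - 1 else 0 := by
  rcases eq_or_ne r 0 with rfl | hr
  · simp only [gaussSum, AddChar.mulShift_zero, AddChar.one_apply, mul_one, MulChar.map_zero,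
      zero_mul, zero_add, true_and, sum_apply_eq_ite]
  · rw [if_neg fun h ↦ hr h.1, add_zero]
    exact gaussSum_mulShift_eq χ ψ (Units.mk0 r hr)

theorem gaussSum_mul_gaussSum_eq_sum_mulShift (a c : MulChar F R) :
    gaussSum a ψ * gaussSum c ψ = ∑ k, c k * gaussSum (a * c) (ψ.mulShift (1 + k)) := by
  simp_rw [gaussSum, Finset.sum_mul_sum, Finset.mul_sum]
  rw [Finset.sum_comm (γ := F) (f := fun k s ↦ c k * _)]
  refine Finset.sum_congr rfl fun s _ ↦ ?_
  rcases eq_or_ne s 0 with rfl | hs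
  · simp only [MulChar.map_zero, zero_mul, mul_zero]
  · rw [← Equiv.sum_comp (Equiv.mulLeft₀ s hs)]
    refine Finset.sum_congr rfl fun k _ ↦ ?_
    rw [Equiv.mulLeft₀_apply, AddChar.mulShift_apply, add_mul, one_mul, mul_comm k,
      AddChar.map_add_eq_mul, map_mul, MulChar.mul_apply]
    ring

variable [IsDomain R] [HasEnoughRootsOfUnity R (Monoid.exponent Fˣ)] [Fintype (MulChar F R)]

theorem sum_gaussSum_mul_eq_sum_mulShift (a b c d : MulChar F R) :
    ∑ χ, gaussSum (a * χ) ψ * gaussSum (c * χ⁻¹) ψ * (gaussSum (b * χ) ψ * gaussSum (d * χ⁻¹) ψ) =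
      (Fintype.card F - 1) * ∑ k, (b * c) k *
        (gaussSum (a * c) (ψ.mulShift (1 + k)) * gaussSum (b * d) (ψ.mulShift (1 + k))) := by
  have h_mellin (χ : MulChar F R) : gaussSum (a * χ) ψ * gaussSum (c * χ⁻¹) ψ =
      mellinTransform (fun k ↦ c k * gaussSum (a * c) (ψ.mulShift (1 + k))) χ := by
    rw [gaussSum_mul_gaussSum_eq_sum_mulShift, mul_mul_mul_comm, mul_inv_cancel, mul_one]
    exact Finset.sum_congr rfl fun k _ ↦ by rw [MulChar.mul_apply]; ring
  have h_series (χ : MulChar F R) : gaussSum (b * χ) ψ * gaussSum (d * χ⁻¹) ψ =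
      ∑ k, χ k * (b k * gaussSum (b * d) (ψ.mulShift (1 + k))) := by
    rw [mul_comm, gaussSum_mul_gaussSum_eq_sum_mulShift, mul_mul_mul_comm, inv_mul_cancel, mul_one,
      mul_comm d]
    exact Finset.sum_congr rfl fun k _ ↦ by rw [MulChar.mul_apply]; ring
  simp_rw [h_mellin, h_series]
  rw [sum_mellinTransform_mul _ _ (by rw [MulChar.map_zero, zero_mul])]
  congr 1
  exact Finset.sum_congr rfl fun k _ ↦ by rw [MulChar.mul_apply]; ring

/-- The `if` is the contribution of the point `k = -1` to the sum in
`sum_gaussSum_mul_eq_sum_mulShift`. -/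
theorem sum_gaussSum_mul [DecidableEq (MulChar F R)] (a b c d : MulChar F R) :
    ∑ χ, gaussSum (a * χ) ψ * gaussSum (c * χ⁻¹) ψ * (gaussSum (b * χ) ψ * gaussSum (d * χ⁻¹) ψ) =
      (Fintype.card F - 1) * (b * c) (-1) *
        (jacobiSum (b * c) (a * b * c * d)⁻¹ * (gaussSum (a * c) ψ * gaussSum (b * d) ψ) +
          if a * c = 1 ∧ b * d = 1 then ((Fintype.card F : R) - 1) ^ 2 else 0) := by
  classical
  have h_term (k : F) : (b * c) k *
      (gaussSum (a * c) (ψ.mulShift (1 + k)) * gaussSum (b * d) (ψ.mulShift (1 + k))) =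
      (b * c) k * (a * b * c * d)⁻¹ (1 + k) * (gaussSum (a * c) ψ * gaussSum (b * d) ψ) +
        if k = -1 then (b * c) (-1) *
          (if a * c = 1 ∧ b * d = 1 then ((Fintype.card F : R) - 1) ^ 2 else 0) else 0 := by
    have h_char : (a * b * c * d)⁻¹ = (a * c)⁻¹ * (b * d)⁻¹ := by
      rw [← mul_inv, mul_mul_mul_comm, mul_assoc (a * b)]
    rw [gaussSum_mulShift_eq_add_ite, gaussSum_mulShift_eq_add_ite, h_char,
      MulChar.mul_apply (a * c)⁻¹]
    rcases eq_or_ne k (-1) with rfl | hk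
    · simp only [add_neg_cancel, MulChar.map_zero, zero_mul, mul_zero, zero_add, true_and, if_true,
        ite_and]
      split_ifs <;> ring
    · have hk' : 1 + k ≠ 0 := fun h ↦ hk (neg_eq_of_add_eq_zero_right h).symm
      simp only [hk, hk', false_and, if_false, add_zero]
      ring
  rw [sum_gaussSum_mul_eq_sum_mulShift]
  simp_rw [h_term]
  rw [Finset.sum_add_distrib, ← Finset.sum_mul, sum_mul_apply_one_add, Finset.sum_ite_eq',
    if_pos (Finset.mem_univ _)]
  ring

end Barnes

/-! ### The quadratic character -/

section Quadratic

theorem four_ne_zero_of_ringChar_ne_two {F : Type*} [Field F] (hF : ringChar F ≠ 2) :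
    (4 : F) ≠ 0 := by
  rw [show (4 : F) = 2 * 2 by norm_num]
  exact mul_self_ne_zero.mpr (Ring.two_ne_zero hF)

variable {F : Type*} [Field F] [Fintype F] [DecidableEq F]

theorem phi_mul_self : phi F * phi F = 1 := by
  rw [← sq, phi, ((quadraticChar_isQuadratic F).comp _).sq_eq_one]

theorem phi_inv : (phi F)⁻¹ = phi F :=
  inv_eq_of_mul_eq_one_left phi_mul_self

theorem phi_ne_one (hF : ringChar F ≠ 2) : phi F ≠ 1 :=
  (MulChar.ringHomComp_ne_one_iff Int.cast_injective).mpr (quadraticChar_ne_one hF)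

theorem sq_eq_one_iff_eq_one_or_eq_phi (hF : ringChar F ≠ 2) {χ : MulChar F ℂ} :
    χ ^ 2 = 1 ↔ χ = 1 ∨ χ = phi F := by
  obtain ⟨g, hg⟩ := IsCyclic.exists_generator (α := Fˣ)
  have apply_generator (η : MulChar F ℂ) (hη : η ^ 2 = 1) : η g = 1 ∨ η g = -1 := by
    rw [← mul_self_eq_one_iff, ← MulChar.mul_apply, ← sq, hη, MulChar.one_apply_coe]
  have eq_one_iff (η : MulChar F ℂ) : η = 1 ↔ η g = 1 := by
    rw [MulChar.eq_iff hg, MulChar.one_apply_coe]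
  have phi_generator : phi F g = -1 :=
    (apply_generator _ (by rw [sq, phi_mul_self])).resolve_left
      fun h ↦ phi_ne_one hF ((eq_one_iff _).mpr h)
  constructor
  · rw [eq_one_iff χ, MulChar.eq_iff hg χ, phi_generator]
    exact apply_generator χ
  · rintro (rfl | rfl)
    · exact one_pow 2
    · rw [sq, phi_mul_self]

theorem sum_comp_sq (hF : ringChar F ≠ 2) (f : F → ℂ) :
    ∑ v : F, f (v ^ 2) = ∑ u : F, (1 + phi F u) * f u := by
  have h_card_sqrts (u : F) : (1 + phi F u) = ∑ v : F, if v ^ 2 = u then (1 : ℂ) else 0 := by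
    have h := congrArg (Int.cast : ℤ → ℂ) (quadraticChar_card_sqrts hF u)
    rw [Set.toFinset_ofPred] at h
    push_cast at h
    rw [Finset.sum_boole, h, add_comm]
    rfl
  simp_rw [h_card_sqrts, Finset.sum_mul, ite_mul, one_mul, zero_mul]
  rw [Finset.sum_comm]
  simp_rw [Finset.sum_ite_eq, Finset.mem_univ, if_true]

theorem jacobiSum_self (hF : ringChar F ≠ 2) {χ : MulChar F ℂ} (hχ : χ ≠ 1) :
    jacobiSum χ χ = χ⁻¹ 4 * jacobiSum (phi F) χ := by
  have h_two : (2 : F) ≠ 0 := Ring.two_ne_zero hF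
  have h_four : (4 : F) ≠ 0 := four_ne_zero_of_ringChar_ne_two hF
  have h_sum : ∑ u, χ (1 - u) = 0 := by
    rw [← MulChar.sum_eq_zero_of_ne_one hχ]
    exact (Equiv.subLeft (1 : F)).sum_comp χ
  have h_sq : jacobiSum χ χ = ∑ v, χ⁻¹ 4 * χ (1 - v ^ 2) := by
    refine (Fintype.sum_equiv ((Equiv.addLeft (1 : F)).trans (Equiv.mulRight₀ (2 : F)⁻¹
      (inv_ne_zero h_two))) _ _ fun v ↦ ?_).symm
    rw [MulChar.inv_apply', ← map_mul, ← map_mul, Equiv.trans_apply, Equiv.coe_addLeft,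
      Equiv.mulRight₀_apply]
    congr 1
    field_simp
    ring
  rw [h_sq, ← Finset.mul_sum, sum_comp_sq hF (fun u ↦ χ (1 - u))]
  simp_rw [add_mul, one_mul]
  rw [Finset.sum_add_distrib, h_sum, zero_add, jacobiSum]

/-- The case of two factors of the Hasse–Davenport product formula. -/
theorem gaussSum_duplication {ψ : AddChar F ℂ} (hψ : ψ.IsPrimitive) (hF : ringChar F ≠ 2)
    (χ : MulChar F ℂ) :
    χ 4 * (gaussSum χ ψ * gaussSum (phi F * χ) ψ) = gaussSum (χ ^ 2) ψ * gaussSum (phi F) ψ := by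
  by_cases hχ : χ ^ 2 = 1
  · have h_four : χ 4 = 1 := by
      rw [show (4 : F) = 2 ^ 2 by norm_num, map_pow, ← MulChar.pow_apply' _ two_ne_zero, hχ,
        MulChar.one_apply (Ring.two_ne_zero hF).isUnit]
    rw [h_four, hχ, one_mul]
    rcases (sq_eq_one_iff_eq_one_or_eq_phi hF).mp hχ with rfl | rfl
    · rw [mul_one]
    · rw [phi_mul_self, mul_comm]
  · have hχ_one : χ ≠ 1 := fun h ↦ hχ ((sq_eq_one_iff_eq_one_or_eq_phi hF).mpr (Or.inl h))
    have hχ_phi : phi F * χ ≠ 1 := fun h ↦ hχ ((sq_eq_one_iff_eq_one_or_eq_phi hF).mpr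
      (Or.inr ((eq_inv_of_mul_eq_one_right h).trans phi_inv)))
    have h_self := jacobiSum_mul_nontrivial (sq χ ▸ hχ) ψ
    have h_phi := jacobiSum_mul_nontrivial hχ_phi ψ
    rw [← sq, jacobiSum_self hF hχ_one] at h_self
    refine mul_left_cancel₀ (gaussSum_ne_zero hψ χ) ?_
    linear_combination -χ 4 * gaussSum (phi F * χ) ψ * h_self + gaussSum (χ ^ 2) ψ * h_phi +
      gaussSum (χ ^ 2) ψ * gaussSum (phi F * χ) ψ * jacobiSum (phi F) χ *
        inv_apply_mul_apply χ (four_ne_zero_of_ringChar_ne_two hF)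

end Quadratic

/-! ### The period function `₂ℙ₁` -/

section Period

variable {F : Type*} [Field F]

theorem P21_summand_rescale (A₁ A₂ B₁ : MulChar F ℂ) {a w : F} (ha : a ≠ 0) (hw : w ≠ 0)
    (y z : F) :
    A₂ y * (A₂⁻¹ * B₁) z * A₁⁻¹ w =
      A₂⁻¹ a * (A₂ (a * y * w⁻¹) * (A₂⁻¹ * B₁) (z * w⁻¹) * (B₁ * A₁⁻¹)⁻¹ w⁻¹) := by
  have h_cancel : A₂⁻¹ a * A₂ a * (A₂⁻¹ w⁻¹ * A₂ w⁻¹) * (B₁⁻¹ w⁻¹ * B₁ w⁻¹) = 1 := by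
    rw [inv_apply_mul_apply _ ha, inv_apply_mul_apply _ (inv_ne_zero hw),
      inv_apply_mul_apply _ (inv_ne_zero hw), one_mul, one_mul]
  simp only [mul_inv, inv_inv, MulChar.mul_apply, map_mul, MulChar.inv_apply' A₁]
  linear_combination -A₂ y * A₂⁻¹ z * B₁ z * A₁ w⁻¹ * h_cancel

variable [Fintype F]

theorem mellinTransform_P21 (A₁ A₂ B₁ χ : MulChar F ℂ) :
    mellinTransform (P21 A₁ A₂ B₁) χ =
      jacobiSum χ⁻¹ A₁⁻¹ * jacobiSum (A₂ * χ) (A₂⁻¹ * B₁) := by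
  have h_scale {y : F} (hy : y ≠ 0) : ∑ l, χ⁻¹ l * A₁⁻¹ (1 - l * y) =
      χ y * jacobiSum χ⁻¹ A₁⁻¹ := by
    rw [jacobiSum, Finset.mul_sum]
    refine Fintype.sum_equiv (Equiv.mulRight₀ y hy) _ _ fun l ↦ ?_
    rw [Equiv.mulRight₀_apply, map_mul]
    linear_combination -χ⁻¹ l * A₁⁻¹ (1 - l * y) * inv_apply_mul_apply χ hy
  simp_rw [mellinTransform, P21, P10, Finset.mul_sum]
  rw [Finset.sum_comm, jacobiSum.eq_def (A₂ * χ), Finset.mul_sum]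
  refine Finset.sum_congr rfl fun y _ ↦ ?_
  simp_rw [mul_left_comm (χ⁻¹ _)]
  rw [← Finset.mul_sum]
  rcases eq_or_ne y 0 with rfl | hy
  · simp only [MulChar.map_zero, zero_mul, mul_zero]
  · rw [h_scale hy, MulChar.mul_apply A₂ χ]
    ring

theorem P21_zero (A₁ A₂ B₁ : MulChar F ℂ) : P21 A₁ A₂ B₁ 0 = jacobiSum A₂ (A₂⁻¹ * B₁) := by
  simp only [P21, P10, jacobiSum, zero_mul, sub_zero, MulChar.map_one, mul_one]

theorem P21_one (A₁ A₂ B₁ : MulChar F ℂ) :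
    P21 A₁ A₂ B₁ 1 = jacobiSum A₂ (A₂⁻¹ * B₁ * A₁⁻¹) := by
  simp only [P21, P10, jacobiSum, one_mul, MulChar.mul_apply, mul_assoc]

/-- Kummer's evaluation, which reduces to Jacobi sums because the summand depends only on `y²`. -/
theorem P21_neg_one [DecidableEq F] (hF : ringChar F ≠ 2) (A D : MulChar F ℂ) :
    P21 A (D ^ 2) (D ^ 2 * A⁻¹) (-1) = jacobiSum D A⁻¹ + jacobiSum (D * phi F) A⁻¹ := by
  have h_even (y : F) : (D ^ 2) y * ((D ^ 2)⁻¹ * (D ^ 2 * A⁻¹)) (1 - y) * P10 A (-1 * y) =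
      D (y ^ 2) * A⁻¹ (1 - y ^ 2) := by
    rw [inv_mul_cancel_left, P10, MulChar.pow_apply' _ two_ne_zero, ← map_pow, mul_assoc,
      ← map_mul]
    congr 2
    ring
  simp_rw [P21, h_even, sum_comp_sq hF fun u ↦ D u * A⁻¹ (1 - u), jacobiSum,
    ← Finset.sum_add_distrib, MulChar.mul_apply]
  exact Finset.sum_congr rfl fun u _ ↦ by ring

theorem P21_pfaff (A₁ A₂ B₁ : MulChar F ℂ) {l : F} (hl : l ≠ 1) :
    P21 A₁ A₂ B₁ l = A₂⁻¹ (1 - l) * P21 (B₁ * A₁⁻¹) A₂ B₁ (l / (l - 1)) := by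
  rcases eq_or_ne l 0 with rfl | hl₀
  · rw [sub_zero, MulChar.map_one, one_mul, zero_div, P21_zero, P21_zero]
  have hl₁ : 1 - l ≠ 0 := sub_ne_zero.mpr hl.symm
  have hl₂ : l - 1 ≠ 0 := sub_ne_zero.mpr hl
  -- In the coordinate `w = 1 - l * y` this is `w ↦ (1 - l) / w`; note that it fixes `w = 0`.
  let σ : F → F := fun y ↦ (1 - (1 - l) / (1 - l * y)) / l
  have hσ : Function.Involutive σ := fun y ↦ by
    simp only [σ, mul_div_cancel₀ _ hl₀, sub_sub_cancel, div_div_cancel₀ hl₁,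
      mul_div_cancel_left₀ _ hl₀]
  have h_bij : Function.Bijective fun y ↦ 1 - σ y :=
    (Equiv.subLeft (1 : F)).bijective.comp hσ.bijective
  rw [P21, P21, Finset.mul_sum]
  refine Fintype.sum_bijective _ h_bij _ _ fun y ↦ ?_
  have h_factor : 1 - l / (l - 1) * (1 - σ y) = (1 - l * y)⁻¹ := by
    simp only [σ]
    field_simp
    ring
  rw [P10, P10, h_factor, sub_sub_cancel]
  rcases eq_or_ne (1 - l * y) 0 with hw | hw
  · rw [hw, inv_zero, MulChar.map_zero, MulChar.map_zero, mul_zero, mul_zero, mul_zero]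
  have hσy : σ y = (1 - y) * (1 - l * y)⁻¹ := by
    simp only [σ]
    field_simp
    ring
  have hσy' : 1 - σ y = (1 - l) * y * (1 - l * y)⁻¹ := by
    rw [hσy, eq_mul_inv_iff_mul_eq₀ hw, sub_mul, inv_mul_cancel_right₀ hw]
    ring
  rw [hσy', hσy]
  exact P21_summand_rescale A₁ A₂ B₁ hl₁ hw y (1 - y)

end Period

/-! ### The quadratic substitution -/

section QuadraticTransformation

variable {F : Type*} [Field F] [Fintype F]

theorem mellinTransform_comp_quadratic [Fintype (MulChar F ℂ)] (hF : ringChar F ≠ 2)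
    (η C : MulChar F ℂ) (f : F → ℂ) :
    (Fintype.card F - 1) * mellinTransform (fun x ↦ C⁻¹ (1 + x) * f (4 * x / (1 + x) ^ 2)) η =
      ∑ χ : MulChar F ℂ, mellinTransform f χ *
        (χ 4 * (η * χ) (-1) * jacobiSum (η⁻¹ * χ) (C⁻¹ * (χ ^ 2)⁻¹)) := by
  have h_inversion (x : F) : (Fintype.card F - 1) *
      (η⁻¹ x * (C⁻¹ (1 + x) * f (4 * x / (1 + x) ^ 2))) =
      ∑ χ : MulChar F ℂ, mellinTransform f χ *
        (χ 4 * ((η⁻¹ * χ) x * (C⁻¹ * (χ ^ 2)⁻¹) (1 + x))) := by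
    rcases eq_or_ne x 0 with rfl | hx
    · simp only [MulChar.map_zero, zero_mul, mul_zero, Finset.sum_const_zero]
    rcases eq_or_ne (1 + x) 0 with hx₁ | hx₁
    · simp only [hx₁, MulChar.map_zero, zero_mul, mul_zero, Finset.sum_const_zero]
    have h_arg : 4 * x / (1 + x) ^ 2 ≠ 0 := div_ne_zero
      (mul_ne_zero (four_ne_zero_of_ringChar_ne_two hF) hx) (pow_ne_zero 2 hx₁)
    rw [mul_left_comm, mul_left_comm (_ - 1), ← sum_apply_mul_mellinTransform f h_arg,
      ← mul_assoc, Finset.mul_sum]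
    refine Finset.sum_congr rfl fun χ _ ↦ ?_
    simp only [div_eq_mul_inv, map_mul, MulChar.mul_apply, MulChar.inv_apply', ← inv_pow,
      MulChar.pow_apply' _ two_ne_zero, map_pow]
    ring
  rw [mellinTransform, Finset.mul_sum]
  simp_rw [h_inversion]
  rw [Finset.sum_comm]
  refine Finset.sum_congr rfl fun χ _ ↦ ?_
  rw [← Finset.mul_sum, ← Finset.mul_sum, sum_mul_apply_one_add, MulChar.mul_apply η⁻¹,
    inv_apply_neg_one, ← MulChar.mul_apply, mul_assoc (χ 4)]

theorem sum_gaussSum_mul_eq_jacobiSum_mul_jacobiSum [Fintype (MulChar F ℂ)] {ψ : AddChar F ℂ}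
    (hψ : ψ.IsPrimitive) {B C : MulChar F ℂ} (hC : C (-1) = 1) (hBC : ¬(C = 1 ∧ B = 1))
    (η : MulChar F ℂ) :
    gaussSum B⁻¹ ψ * ∑ χ, gaussSum (η⁻¹ * χ) ψ * gaussSum χ⁻¹ ψ *
        (gaussSum (η * C * χ) ψ * gaussSum (C⁻¹ * B * χ⁻¹) ψ) =
      (Fintype.card F - 1) * Fintype.card F * B (-1) *
        (jacobiSum η⁻¹ B⁻¹ * jacobiSum (C * η) B⁻¹) := by
  classical
  have h_barnes := sum_gaussSum_mul ψ η⁻¹ (η * C) 1 (C⁻¹ * B)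
  have h_char : η * C * (C⁻¹ * B) = η * B := by rw [mul_assoc, mul_inv_cancel_left]
  have h_char' : η⁻¹ * (η * C) * (C⁻¹ * B) = B := by
    rw [inv_mul_cancel_left, mul_inv_cancel_left]
  simp only [one_mul, mul_one, h_char, h_char', MulChar.mul_apply, hC] at h_barnes
  rw [h_barnes, mul_comm C]
  by_cases h : η⁻¹ = 1 ∧ B⁻¹ = 1
  · obtain ⟨rfl, rfl⟩ : η = 1 ∧ B = 1 := ⟨inv_eq_one.mp h.1, inv_eq_one.mp h.2⟩
    have hC₁ : C ≠ 1 := fun hC₁ ↦ hBC ⟨hC₁, rfl⟩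
    simp only [inv_one, one_mul, mul_one, and_self, if_true, jacobiSum_one_one,
      jacobiSum_comm C, jacobiSum_one_nontrivial hC₁, gaussSum_one_of_isPrimitive hψ,
      MulChar.one_apply isUnit_one.neg]
    ring
  · have h_ite : ¬(η⁻¹ = 1 ∧ η * B = 1) := by
      rintro ⟨hη, hηB⟩
      rw [inv_eq_one.mp hη, one_mul] at hηB
      exact h ⟨hη, inv_eq_one.mpr hηB⟩
    have h_card := card_mul_jacobiSum hψ h
    rw [mul_inv, inv_inv, inv_inv, MulChar.mul_apply, inv_apply_neg_one, inv_apply_neg_one]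
      at h_card
    rw [if_neg h_ite]
    linear_combination -(Fintype.card F - 1) * B (-1) * jacobiSum (η * C) B⁻¹ * h_card
      - (Fintype.card F - 1) * η (-1) * jacobiSum (η * C) B⁻¹ * gaussSum η⁻¹ ψ * gaussSum B⁻¹ ψ
        * gaussSum (η * B) ψ * apply_neg_one_mul_self B

variable [DecidableEq F]

theorem jacobiSum_mul_jacobiSum_eq_gaussSum {ψ : AddChar F ℂ} (hψ : ψ.IsPrimitive)
    (hF : ringChar F ≠ 2) {B D : MulChar F ℂ} (hD : D ≠ phi F) (hBD : B ≠ D) (χ : MulChar F ℂ) :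
    D 4 * gaussSum (phi F * D) ψ * gaussSum (D * B⁻¹)⁻¹ ψ *
        (χ 4 * (jacobiSum χ⁻¹ (D * phi F)⁻¹ * jacobiSum (D * χ) (D * B⁻¹))) =
      D (-1) * gaussSum (phi F) ψ *
        (gaussSum χ⁻¹ ψ * gaussSum ((D ^ 2)⁻¹ * B * χ⁻¹) ψ * gaussSum ((D * χ) ^ 2) ψ) := by
  classical
  have h_left := jacobiSum_mul_gaussSum_inv hψ χ⁻¹ (D * phi F)⁻¹
  have h_right := jacobiSum_mul_gaussSum_inv hψ (D * χ) (D * B⁻¹)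
  have h_dup := gaussSum_duplication hψ hF (D * χ)
  have hDφ : (D * phi F)⁻¹ ≠ 1 := fun h ↦ hD
    (eq_inv_of_mul_eq_one_left (inv_eq_one.mp h) |>.trans phi_inv)
  have hDB : D * B⁻¹ ≠ 1 := fun h ↦ hBD (mul_inv_eq_one.mp h).symm
  have h_char : (χ⁻¹ * (D * phi F)⁻¹)⁻¹ = phi F * (D * χ) := by
    rw [mul_inv, inv_inv, inv_inv, mul_comm χ, mul_comm D, mul_assoc]
  have h_char' : (D * χ * (D * B⁻¹))⁻¹ = (D ^ 2)⁻¹ * B * χ⁻¹ := by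
    rw [mul_mul_mul_comm, ← sq, mul_inv, mul_inv, inv_inv, mul_comm χ⁻¹, mul_assoc]
  rw [if_neg hDφ, sub_zero, h_char, inv_inv, mul_comm D, inv_apply_neg_one] at h_left
  rw [if_neg hDB, sub_zero, h_char', MulChar.mul_apply] at h_right
  rw [MulChar.mul_apply D χ 4] at h_dup
  rw [mul_comm D (phi F)]
  linear_combination D 4 * χ 4 * jacobiSum (D * χ) (D * B⁻¹) * gaussSum (D * B⁻¹)⁻¹ ψ * h_left +
    D 4 * χ 4 * χ (-1) * gaussSum χ⁻¹ ψ * gaussSum (phi F * (D * χ)) ψ * h_right +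
    D 4 * χ 4 * D (-1) * gaussSum χ⁻¹ ψ * gaussSum (phi F * (D * χ)) ψ * gaussSum (D * χ) ψ *
      gaussSum ((D ^ 2)⁻¹ * B * χ⁻¹) ψ * apply_neg_one_mul_self χ +
    D (-1) * gaussSum χ⁻¹ ψ * gaussSum ((D ^ 2)⁻¹ * B * χ⁻¹) ψ * h_dup

/-- The correction term comes from the characters for which the last Jacobi sum has a trivial
argument; apart from the factor `η (-1)` it does not depend on `η`. -/
theorem mellinTransform_P21_mul_jacobiSum [DecidableEq (MulChar F ℂ)] {ψ : AddChar F ℂ}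
    (hψ : ψ.IsPrimitive) (hF : ringChar F ≠ 2) {B D : MulChar F ℂ} (hD : D ≠ phi F) (hBD : B ≠ D)
    (η χ : MulChar F ℂ) :
    D 4 * gaussSum (phi F * D) ψ * gaussSum (D * B⁻¹)⁻¹ ψ *
        (mellinTransform (P21 (D * phi F) D (D ^ 2 * B⁻¹)) χ *
          (χ 4 * (η * χ) (-1) * jacobiSum (η⁻¹ * χ) ((D ^ 2)⁻¹ * (χ ^ 2)⁻¹))) =
      D (-1) * gaussSum (phi F) ψ *
        (gaussSum (η⁻¹ * χ) ψ * gaussSum χ⁻¹ ψ *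
            (gaussSum (η * D ^ 2 * χ) ψ * gaussSum ((D ^ 2)⁻¹ * B * χ⁻¹) ψ) -
          η (-1) * if (D * χ) ^ 2 = 1 then
            (Fintype.card F - 1) * χ (-1) * gaussSum χ⁻¹ ψ * gaussSum ((D ^ 2)⁻¹ * B * χ⁻¹) ψ
            else 0) := by
  have h_gauss := jacobiSum_mul_jacobiSum_eq_gaussSum hψ hF hD hBD χ
  have h_jacobi := jacobiSum_mul_gaussSum_inv hψ (η⁻¹ * χ) ((D * χ) ^ 2)⁻¹
  have h_char : (η⁻¹ * χ * ((D * χ) ^ 2)⁻¹)⁻¹ = η * D ^ 2 * χ := by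
    rw [mul_inv, mul_inv, inv_inv, inv_inv, mul_pow, sq χ, mul_mul_mul_comm, inv_mul_cancel_left]
  have h_char' : D⁻¹ * (D ^ 2 * B⁻¹) = D * B⁻¹ := by
    rw [sq, mul_assoc, inv_mul_cancel_left]
  simp only [h_char, inv_inv, inv_eq_one, MulChar.mul_apply η⁻¹ χ (-1), inv_apply_neg_one]
    at h_jacobi
  rw [mellinTransform_P21, h_char', ← mul_inv, ← mul_pow, MulChar.mul_apply η χ]
  have h_sign : η (-1) * χ (-1) * (η (-1) * χ (-1)) = 1 := by
    rw [← MulChar.mul_apply, apply_neg_one_mul_self]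
  split_ifs at h_jacobi ⊢ with h
  all_goals
    linear_combination η (-1) * χ (-1) * jacobiSum (η⁻¹ * χ) ((D * χ) ^ 2)⁻¹ * h_gauss
      + D (-1) * gaussSum (phi F) ψ * gaussSum χ⁻¹ ψ * gaussSum ((D ^ 2)⁻¹ * B * χ⁻¹) ψ *
        (η (-1) * χ (-1) * h_jacobi
          + gaussSum (η⁻¹ * χ) ψ * gaussSum (η * D ^ 2 * χ) ψ * h_sign)

theorem not_sq_eq_one_and_inv_eq_one (hF : ringChar F ≠ 2) {B D : MulChar F ℂ} (hD : D ≠ phi F)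
    (hBD : B ≠ D) : ¬(D ^ 2 = 1 ∧ B⁻¹ = 1) := by
  rintro ⟨hD₂, hB⟩
  exact hBD ((inv_eq_one.mp hB).trans
    (((sq_eq_one_iff_eq_one_or_eq_phi hF).mp hD₂).resolve_right hD).symm)

theorem jacobiSum_sq_inv_mul_gaussSum {ψ : AddChar F ℂ} (hψ : ψ.IsPrimitive) (hF : ringChar F ≠ 2)
    {B D : MulChar F ℂ} (hD : D ≠ phi F) (hBD : B ≠ D) :
    jacobiSum (D ^ 2) B⁻¹ * (gaussSum (phi F) ψ * gaussSum (D * B⁻¹) ψ) =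
      D 4 * jacobiSum D (D * B⁻¹) * (gaussSum (phi F * D) ψ * gaussSum B⁻¹ ψ) := by
  have hDB : D * B⁻¹ ≠ 1 := fun h ↦ hBD (mul_inv_eq_one.mp h).symm
  have h_ratio := jacobiSum_mul_gaussSum_mul_gaussSum hψ
    (by rw [sq, mul_assoc] : D ^ 2 * B⁻¹ = D * (D * B⁻¹))
    (not_sq_eq_one_and_inv_eq_one hF hD hBD) (fun h ↦ hDB h.2)
  refine mul_left_cancel₀ (gaussSum_ne_zero hψ (D ^ 2)) ?_
  linear_combination D 4 * gaussSum (phi F * D) ψ * h_ratio -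
    jacobiSum (D ^ 2) B⁻¹ * gaussSum (D * B⁻¹) ψ * gaussSum_duplication hψ hF D

theorem exists_mellinTransform_quadratic_eq_sum_gaussSum [Fintype (MulChar F ℂ)]
    {ψ : AddChar F ℂ} (hψ : ψ.IsPrimitive) (hF : ringChar F ≠ 2) {B D : MulChar F ℂ}
    (hD : D ≠ phi F) (hBD : B ≠ D) :
    ∃ E : ℂ, ∀ η : MulChar F ℂ,
      D 4 * gaussSum (phi F * D) ψ * gaussSum (D * B⁻¹)⁻¹ ψ *
          ((Fintype.card F - 1) * mellinTransform (fun x ↦ (D ^ 2)⁻¹ (1 + x) *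
            P21 (D * phi F) D (D ^ 2 * B⁻¹) (4 * x / (1 + x) ^ 2)) η) =
        D (-1) * gaussSum (phi F) ψ * (∑ χ, gaussSum (η⁻¹ * χ) ψ * gaussSum χ⁻¹ ψ *
          (gaussSum (η * D ^ 2 * χ) ψ * gaussSum ((D ^ 2)⁻¹ * B * χ⁻¹) ψ) - η (-1) * E) := by
  classical
  refine ⟨∑ χ : MulChar F ℂ, if (D * χ) ^ 2 = 1 then
    (Fintype.card F - 1) * χ (-1) * gaussSum χ⁻¹ ψ * gaussSum ((D ^ 2)⁻¹ * B * χ⁻¹) ψ else 0,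
    fun η ↦ ?_⟩
  rw [mellinTransform_comp_quadratic hF, Finset.mul_sum]
  simp_rw [mellinTransform_P21_mul_jacobiSum hψ hF hD hBD η, ← Finset.mul_sum,
    Finset.sum_sub_distrib, ← Finset.mul_sum]

theorem exists_mellinTransform_quadratic (hF : ringChar F ≠ 2) {B D : MulChar F ℂ}
    (hD : D ≠ phi F) (hBD : B ≠ D) :
    ∃ c : ℂ, ∀ η : MulChar F ℂ,
      jacobiSum (D ^ 2) B⁻¹ * mellinTransform (fun x ↦ (D ^ 2)⁻¹ (1 + x) *
          P21 (D * phi F) D (D ^ 2 * B⁻¹) (4 * x / (1 + x) ^ 2)) η =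
        jacobiSum D (D * B⁻¹) * mellinTransform (P21 B (D ^ 2) (D ^ 2 * B⁻¹)) η +
          c * η⁻¹ (-1) := by
  cases nonempty_fintype (MulChar F ℂ)
  have hψ := AddChar.FiniteField.primitiveChar_to_Complex_isPrimitive F
  set ψ := AddChar.FiniteField.primitiveChar_to_Complex F
  obtain ⟨E, hE⟩ := exists_mellinTransform_quadratic_eq_sum_gaussSum hψ hF hD hBD
  have hq : (Fintype.card F : ℂ) * (Fintype.card F - 1) ≠ 0 :=
    mul_ne_zero cast_card_ne_zero cast_card_sub_one_ne_zero
  obtain ⟨c, hc⟩ : ∃ c : ℂ, Fintype.card F * (Fintype.card F - 1) * c =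
      -(jacobiSum D (D * B⁻¹) * B (-1) * gaussSum B⁻¹ ψ * E) := ⟨_, mul_div_cancel₀ _ hq⟩
  refine ⟨c, fun η ↦ ?_⟩
  have hDB : D * B⁻¹ ≠ 1 := fun h ↦ hBD (mul_inv_eq_one.mp h).symm
  have h_sum := hE η
  have h_barnes := sum_gaussSum_mul_eq_jacobiSum_mul_jacobiSum hψ
    (by rw [MulChar.pow_apply' _ two_ne_zero, sq, apply_neg_one_mul_self] : (D ^ 2) (-1) = 1)
    (fun h ↦ not_sq_eq_one_and_inv_eq_one hF hD hBD ⟨h.1, inv_eq_one.mpr h.2⟩) η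
  have h_jacobi := jacobiSum_sq_inv_mul_gaussSum hψ hF hD hBD
  have h_inv := gaussSum_mul_gaussSum_inv hψ hDB
  rw [MulChar.mul_apply, inv_apply_neg_one] at h_inv
  have hD_sign := apply_neg_one_mul_self D
  have hB_sign := apply_neg_one_mul_self B
  rw [mellinTransform_P21 B, inv_mul_cancel_left, inv_apply_neg_one]
  refine mul_left_cancel₀ (mul_ne_zero (gaussSum_ne_zero hψ (phi F)) hq) ?_
  generalize mellinTransform _ η = M at h_sum ⊢
  generalize ∑ χ, gaussSum (η⁻¹ * χ) ψ * _ * _ = S at h_sum h_barnes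
  linear_combination
    -gaussSum (phi F) ψ * Fintype.card F * (Fintype.card F - 1) * jacobiSum (D ^ 2) B⁻¹ * M *
      (B (-1) * B (-1) * hD_sign + hB_sign)
    + D (-1) * B (-1) * (Fintype.card F - 1) * M *
      (gaussSum (D * B⁻¹)⁻¹ ψ * h_jacobi - gaussSum (phi F) ψ * jacobiSum (D ^ 2) B⁻¹ * h_inv)
    + D (-1) * B (-1) * jacobiSum D (D * B⁻¹) * gaussSum B⁻¹ ψ * h_sum
    + jacobiSum D (D * B⁻¹) * gaussSum (phi F) ψ * (
      B (-1) * gaussSum B⁻¹ ψ * (S - η (-1) * E) * hD_sign + B (-1) * h_barnes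
      + Fintype.card F * (Fintype.card F - 1) * jacobiSum η⁻¹ B⁻¹ * jacobiSum (D ^ 2 * η) B⁻¹ *
        hB_sign)
    - gaussSum (phi F) ψ * η (-1) * hc

theorem jacobiSum_mul_P21_comp_quadratic (hF : ringChar F ≠ 2) {B D : MulChar F ℂ}
    (hD : D ≠ phi F) (hBD : B ≠ D) {x : F} (hx : x ≠ 0) (hx₁ : x ≠ -1) :
    jacobiSum (D ^ 2) B⁻¹ * ((D ^ 2)⁻¹ (1 + x) *
        P21 (D * phi F) D (D ^ 2 * B⁻¹) (4 * x / (1 + x) ^ 2)) =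
      jacobiSum D (D * B⁻¹) * P21 B (D ^ 2) (D ^ 2 * B⁻¹) x := by
  obtain ⟨c, hc⟩ := exists_mellinTransform_quadratic hF hD hBD
  refine sub_eq_zero.mp (eq_zero_of_mellinTransform_eq
    (f := fun x ↦ _ * ((D ^ 2)⁻¹ (1 + x) * P21 _ _ _ (4 * x / (1 + x) ^ 2)) - _ * P21 _ _ _ x)
    (c := c) (fun η ↦ ?_) hx hx₁)
  rw [mellinTransform_mul_sub_mul, hc η, add_sub_cancel_left]

theorem P21_pfaff_quadratic (B D : MulChar F ℂ) {x : F} (hx : x ≠ 1) (hx₁ : x ≠ -1) :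
    (D ^ 2)⁻¹ (1 - x) * P21 (D * phi F * B⁻¹) D (D ^ 2 * B⁻¹) (-4 * x / (1 - x) ^ 2) =
      (D ^ 2)⁻¹ (1 + x) * P21 (D * phi F) D (D ^ 2 * B⁻¹) (4 * x / (1 + x) ^ 2) := by
  have h_sub : 1 - x ≠ 0 := sub_ne_zero.mpr hx.symm
  have h_add : 1 + x ≠ 0 := fun h ↦ hx₁ (neg_eq_of_add_eq_zero_right h).symm
  have h_one_sub : 1 - 4 * x / (1 + x) ^ 2 = ((1 - x) / (1 + x)) ^ 2 := by
    field_simp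
    ring
  have h_ne : 4 * x / (1 + x) ^ 2 ≠ 1 := fun h ↦
    pow_ne_zero 2 (div_ne_zero h_sub h_add) (by rw [← h_one_sub, h, sub_self])
  have h_arg : 4 * x / (1 + x) ^ 2 / (4 * x / (1 + x) ^ 2 - 1) = -4 * x / (1 - x) ^ 2 := by
    rw [← neg_sub 1, h_one_sub]
    field_simp
  have h_char : D ^ 2 * B⁻¹ * (D * phi F)⁻¹ = D * phi F * B⁻¹ := by
    rw [mul_inv_eq_iff_eq_mul, mul_right_comm, mul_mul_mul_comm, phi_mul_self, mul_one, sq]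
  have h_factor : (D ^ 2)⁻¹ (1 + x) * D⁻¹ (((1 - x) / (1 + x)) ^ 2) = (D ^ 2)⁻¹ (1 - x) := by
    rw [← inv_pow, MulChar.pow_apply' _ two_ne_zero, MulChar.pow_apply' _ two_ne_zero, ← map_pow,
      ← map_pow, ← map_mul, ← mul_pow, mul_div_cancel₀ _ h_add]
  rw [P21_pfaff _ _ _ h_ne, h_one_sub, h_arg, h_char, ← mul_assoc, h_factor]

theorem jacobiSum_sq_inv_mul_jacobiSum_phi (hF : ringChar F ≠ 2) {B D : MulChar F ℂ}
    (hD : D ≠ phi F) (hBD : B ≠ D) :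
    jacobiSum (D ^ 2) B⁻¹ * (D⁻¹ 4 * jacobiSum D (phi F)) =
      jacobiSum D (D * B⁻¹) * jacobiSum D B⁻¹ := by
  have hψ := AddChar.FiniteField.primitiveChar_to_Complex_isPrimitive F
  set ψ := AddChar.FiniteField.primitiveChar_to_Complex F
  have hDφ : D * phi F ≠ 1 := fun h ↦ hD ((eq_inv_of_mul_eq_one_left h).trans phi_inv)
  have hDB : D * B⁻¹ ≠ 1 := fun h ↦ hBD (mul_inv_eq_one.mp h).symm
  have h_jacobi := jacobiSum_sq_inv_mul_gaussSum hψ hF hD hBD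
  have h_phi := jacobiSum_mul_nontrivial hDφ ψ
  have h_B := jacobiSum_mul_nontrivial hDB ψ
  have h_four := inv_apply_mul_apply D (four_ne_zero_of_ringChar_ne_two hF)
  rw [mul_comm D (phi F)] at h_phi
  refine mul_left_cancel₀ (mul_ne_zero (gaussSum_ne_zero hψ (phi F * D))
    (gaussSum_ne_zero hψ (D * B⁻¹))) ?_
  linear_combination D⁻¹ 4 * jacobiSum (D ^ 2) B⁻¹ * gaussSum (D * B⁻¹) ψ * h_phi +
    D⁻¹ 4 * gaussSum D ψ * h_jacobi -
    jacobiSum D (D * B⁻¹) * gaussSum (phi F * D) ψ * (h_B - gaussSum D ψ * gaussSum B⁻¹ ψ * h_four)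

theorem apply_mul_P21_quadratic_neg_one (hF : ringChar F ≠ 2) (B D : MulChar F ℂ) :
    (D ^ 2)⁻¹ (1 - -1) * P21 (D * phi F * B⁻¹) D (D ^ 2 * B⁻¹) (-4 * -1 / (1 - -1) ^ 2) =
      D⁻¹ 4 * jacobiSum D (phi F) := by
  have h_arg : (-4 : F) * -1 / (1 - -1) ^ 2 = 1 := by
    rw [sub_neg_eq_add, one_add_one_eq_two, neg_mul_neg, mul_one]
    exact (div_eq_one_iff_eq (pow_ne_zero 2 (Ring.two_ne_zero hF))).mpr (by norm_num)
  have h_char : D⁻¹ * (D ^ 2 * B⁻¹) * (D * phi F * B⁻¹)⁻¹ = phi F := by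
    rw [sq, mul_assoc D, inv_mul_cancel_left, mul_inv_eq_iff_eq_mul, mul_comm D (phi F), mul_assoc,
      ← mul_assoc (phi F) (phi F), phi_mul_self, one_mul]
  have h_apply : (D ^ 2)⁻¹ (1 - -1) = D⁻¹ 4 := by
    rw [← inv_pow, MulChar.pow_apply' _ two_ne_zero, ← map_pow]
    norm_num
  rw [h_arg, P21_one, h_char, h_apply]

theorem jacobiSum_mul_P21_quadratic (hF : ringChar F ≠ 2) {B D : MulChar F ℂ}
    (hD : D ≠ phi F) (hBD : B ≠ D) (x : F) :
    jacobiSum (D ^ 2) B⁻¹ * ((D ^ 2)⁻¹ (1 - x) *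
        P21 (D * phi F * B⁻¹) D (D ^ 2 * B⁻¹) (-4 * x / (1 - x) ^ 2)) =
      jacobiSum D (D * B⁻¹) * (P21 B (D ^ 2) (D ^ 2 * B⁻¹) x
        - delta (1 - x) * jacobiSum (D ^ 2) (B⁻¹ ^ 2)
        - delta (1 + x) * jacobiSum B⁻¹ (D * phi F)) := by
  have h_two : (2 : F) ≠ 0 := Ring.two_ne_zero hF
  have h_char : D⁻¹ * (D ^ 2 * B⁻¹) = D * B⁻¹ := by rw [sq, mul_assoc, inv_mul_cancel_left]
  rcases eq_or_ne x 0 with rfl | hx₀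
  · rw [mul_zero, zero_div, sub_zero, add_zero, MulChar.map_one, delta, if_neg one_ne_zero,
      P21_zero, P21_zero, h_char, inv_mul_cancel_left]
    ring
  rcases eq_or_ne x 1 with rfl | hx₁
  · rw [sub_self, one_add_one_eq_two, delta, delta, if_pos rfl, if_neg h_two, MulChar.map_zero,
      P21_one, inv_mul_cancel_left, ← sq]
    ring
  rcases eq_or_ne x (-1) with rfl | hx₂
  · rw [apply_mul_P21_quadratic_neg_one hF, jacobiSum_sq_inv_mul_jacobiSum_phi hF hD hBD,
      P21_neg_one hF, sub_neg_eq_add, add_neg_cancel, one_add_one_eq_two, delta, delta,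
      if_neg h_two, if_pos rfl, jacobiSum_comm B⁻¹]
    ring
  · have h_sub : 1 - x ≠ 0 := sub_ne_zero.mpr hx₁.symm
    have h_add : 1 + x ≠ 0 := fun h ↦ hx₂ (neg_eq_of_add_eq_zero_right h).symm
    rw [P21_pfaff_quadratic B D hx₁ hx₂, jacobiSum_mul_P21_comp_quadratic hF hD hBD hx₀ hx₂, delta,
      delta, if_neg h_sub, if_neg h_add]
    ring

end QuadraticTransformation

end FFHyp

end

theorem mainTheorem2 {F : Type*} [Field F] [Fintype F] [DecidableEq F]
    (hF : ringChar F ≠ 2) (B C D : MulChar F ℂ) (hC : C = D ^ 2)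
    (hD : D ≠ FFHyp.phi F) (hBD : B ≠ D) (x : F) :
    C⁻¹ (1 - x) *
        FFHyp.F21 (D * FFHyp.phi F * B⁻¹) D (C * B⁻¹) (-4 * x / (1 - x) ^ 2) =
      FFHyp.F21 B C (C * B⁻¹) x
        - FFHyp.delta (1 - x) * (jacobiSum C (B⁻¹ ^ 2) / jacobiSum C B⁻¹)
        - FFHyp.delta (1 + x) * (jacobiSum B⁻¹ (D * FFHyp.phi F) / jacobiSum C B⁻¹) := by
  subst hC
  have hψ := AddChar.FiniteField.primitiveChar_to_Complex_isPrimitive F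
  have h_denom_left := FFHyp.jacobiSum_ne_zero hψ hF D (D * B⁻¹)
  have h_denom_right := FFHyp.jacobiSum_ne_zero hψ hF (D ^ 2) B⁻¹
  have h_char_left : D ^ 2 * B⁻¹ * D⁻¹ = D * B⁻¹ := by
    rw [sq, mul_right_comm, mul_inv_cancel_right]
  have h_char_right : D ^ 2 * B⁻¹ * (D ^ 2)⁻¹ = B⁻¹ := mul_inv_cancel_comm (D ^ 2) B⁻¹
  have h_periods := FFHyp.jacobiSum_mul_P21_quadratic hF hD hBD x
  rw [FFHyp.F21, FFHyp.F21, h_char_left, h_char_right]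
  generalize -4 * x / (1 - x) ^ 2 = l at h_periods ⊢
  field_simp
  linear_combination h_periods
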